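/- All graphs are finite and simple. A non-increasing sequence $\pi=(d_1,\dots,d_n)$ of nonnegative integers is called graphic if it is the degree sequence of a simple graph $G$ of order $n$; such a $G$ is called a realization of $\pi$. Write $\sigma(\pi)=d_1+\cdots+d_n$. For a graph $H$, let $\sigma(H,n)$ denote the smallest even integer such that every $n$-term graphic sequence $\pi$ with all terms positive and with $\sigma(\pi)\ge\sigma(H,n)$ has a realization containing $H$ as a subgraph. **Theorem.** If $n\ge 37$, then $$\sigma(K_{2,5},n)=\begin{cases}5n-3, & \text{if } n \text{ is odd},\\ 5n-2, & \text{if } n \text{ is even}.\end{cases}$$ -/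

import Mathlib

/-- A finite sequence `d` of natural numbers, listed in non-increasing order, is realized by the
simple graph `G` on the vertex set `Fin n` if vertex `i` has degree `d i` in `G` for every `i`.
(Every simple graph of order `n` whose degree sequence is `d` is isomorphic to such a `G`.) -/
def IsRealization {n : ℕ} (d : Fin n → ℕ) (G : SimpleGraph (Fin n)) : Prop :=
  open scoped Classical in ∀ i, G.degree i = d i

/-- An `n`-term graphic sequence: non-increasing, and the degree sequence of a simple graph. -/
def IsGraphic {n : ℕ} (d : Fin n → ℕ) : Prop :=
  Antitone d ∧ ∃ G : SimpleGraph (Fin n), IsRealization d G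

/-- The sequence `d` is potentially `H`-graphic: it is graphic and some realization of `d`
contains `H` as a (not necessarily induced) subgraph. -/
def IsPotentiallyGraphic {W : Type*} (H : SimpleGraph W) {n : ℕ} (d : Fin n → ℕ) : Prop :=
  Antitone d ∧ ∃ G : SimpleGraph (Fin n), IsRealization d G ∧ H.IsContained G

/-- The even numbers `m` such that every `n`-term positive graphic sequence whose sum is at least
`m` has a realization containing `H`. -/
def forcingSums {W : Type*} (H : SimpleGraph W) (n : ℕ) : Set ℕ :=
  {m | Even m ∧ ∀ d : Fin n → ℕ, IsGraphic d → (∀ i, 0 < d i) → m ≤ ∑ i, d i →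
    IsPotentiallyGraphic H d}

/-- `m` is the number `σ(H, n)`, the least element of `forcingSums H n`. -/
def IsSigma {W : Type*} (H : SimpleGraph W) (n m : ℕ) : Prop :=
  IsLeast (forcingSums H n) m

/-! ### Degree-preserving switches that enlarge a common neighbourhood. -/

section Switching

open scoped Classical

/-! Upper bound: fix two vertices `u`, `v` of large degree and take a realization maximizing their
common neighbourhood `A`. Suppose no pair of vertices has five common neighbours. If `b` is a
private neighbour of `u` and `c` one of `v`, maximality forbids every switch that would enlarge `A`.
So `b` and `c` have the same neighbours apart from `u`, `v` and each other, and outside the small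
set `core` a vertex has at most one neighbour beyond `S = commonNbrs G b c`
(`PrivatePair.card_sdiff_le_one`; `b` and `c` may have two). Since `S` has at most four elements,
few edges remain and the degree sum falls short of `5n - 3`.

If the second largest degree is at least 6, private neighbours on both sides exist automatically
(`exists_five_common_of_six_le`). Otherwise the sum forces the second and third degrees to equal 5,
and private neighbours can be missing only when these two vertices are twins of a `K_6` minus edges
among four vertices; a switch using a far edge then enlarges `A` (`exists_five_common_of_le_five`).

Lower bound: in `extremalSeq` at most two vertices have degree at least 5. One of them dominates the
graph, so the other would need degree 6. -/

lemma ite_mem_sym2 {M : Type*} {a b : M} (h : a ≠ b) (x : M) :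
    (if x ∈ s(a, b) then 1 else 0 : ℕ) = (if x = a then 1 else 0) + if x = b then 1 else 0 := by
  by_cases ha : x = a
  · subst ha; simp [h]
  · simp [ha]

lemma sum_four {M N : Type*} [DecidableEq M] [AddCommMonoid N] (f : M → N) {w x y z : M}
    (h : [w, x, y, z].Nodup) :
    ∑ e ∈ ({w, x, y, z} : Finset M), f e = f w + f x + f y + f z := by
  simp only [List.nodup_cons, List.mem_cons, List.not_mem_nil, or_false, not_or] at h
  rw [Finset.sum_insert (by simpa using h.1), Finset.sum_insert (by simpa using h.2.1),
    Finset.sum_insert (by simpa using h.2.2.1), Finset.sum_singleton]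
  simp only [add_assoc]

variable {V : Type*} [Fintype V]

/-- The common neighbours of two vertices. -/
noncomputable def commonNbrs (G : SimpleGraph V) (u v : V) : Finset V :=
  Finset.univ.filter fun x => G.Adj u x ∧ G.Adj v x

lemma mem_commonNbrs {G : SimpleGraph V} {u v x : V} :
    x ∈ commonNbrs G u v ↔ G.Adj u x ∧ G.Adj v x := by
  simp [commonNbrs]

lemma commonNbrs_comm (G : SimpleGraph V) (u v : V) : commonNbrs G u v = commonNbrs G v u := by
  ext x; simp only [mem_commonNbrs, and_comm]

/-- Exchanging a set `R` of edges for a set `A` of non-edges which covers every vertex equally often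
preserves all degrees. -/
lemma degree_exchange (G : SimpleGraph V) (R A : Finset (Sym2 V))
    (hR : ∀ e ∈ R, e ∈ G.edgeSet) (hA : ∀ e ∈ A, e ∉ G.edgeSet) (hd : ∀ e ∈ A, ¬ e.IsDiag)
    (h : ∀ x, (∑ e ∈ R, if x ∈ e then 1 else 0) = ∑ e ∈ A, if x ∈ e then 1 else 0) (x : V) :
    (SimpleGraph.fromEdgeSet ((G.edgeSet \ R) ∪ A)).degree x = G.degree x := by
  rw [← SimpleGraph.card_incidenceFinset_eq_degree, ← SimpleGraph.card_incidenceFinset_eq_degree]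
  have h1 : (SimpleGraph.fromEdgeSet ((G.edgeSet \ R) ∪ A)).incidenceFinset x =
      (G.incidenceFinset x \ R.filter (x ∈ ·)) ∪ A.filter (x ∈ ·) := by
    ext e
    simp only [SimpleGraph.mem_incidenceFinset, SimpleGraph.incidenceSet,
      SimpleGraph.edgeSet_fromEdgeSet, Finset.mem_union, Finset.mem_sdiff, Finset.mem_filter,
      Set.mem_ofPred_eq, Set.mem_sdiff, Set.mem_union, Finset.mem_coe]
    have h2 := fun he : e ∈ G.edgeSet => G.not_isDiag_of_mem_edgeSet he
    have h3 := hd e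
    have h4 : e ∈ {e : Sym2 V | e.IsDiag} ↔ e.IsDiag := Iff.rfl
    simp only [Sym2.mem_diagSet]
    tauto
  have hdisj : Disjoint (G.incidenceFinset x \ R.filter (x ∈ ·)) (A.filter (x ∈ ·)) := by
    rw [Finset.disjoint_left]
    intro e he he'
    simp only [SimpleGraph.mem_incidenceFinset, SimpleGraph.incidenceSet, Finset.mem_sdiff,
      Finset.mem_filter, Set.mem_ofPred_eq] at he he'
    exact hA e he'.1 he.1.1
  have hsub : R.filter (x ∈ ·) ⊆ G.incidenceFinset x := by
    intro e he
    simp only [SimpleGraph.mem_incidenceFinset, SimpleGraph.incidenceSet,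
      Finset.mem_filter, Set.mem_ofPred_eq] at he ⊢
    exact ⟨hR e he.1, he.2⟩
  have hx := h x
  rw [← Finset.card_filter, ← Finset.card_filter] at hx
  rw [h1, Finset.card_union_of_disjoint hdisj, Finset.card_sdiff_of_subset hsub, ← hx]
  exact Nat.sub_add_cancel (Finset.card_le_card hsub)

lemma exists_exchange (G : SimpleGraph V) (R A : Finset (Sym2 V))
    (hR : ∀ e ∈ R, e ∈ G.edgeSet) (hA : ∀ e ∈ A, e ∉ G.edgeSet) (hd : ∀ e ∈ A, ¬ e.IsDiag)
    (h : ∀ x, (∑ e ∈ R, if x ∈ e then 1 else 0) = ∑ e ∈ A, if x ∈ e then 1 else 0) :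
    ∃ G' : SimpleGraph V, (∀ x, G'.degree x = G.degree x) ∧
      (∀ p q, s(p, q) ∈ A → G'.Adj p q) ∧ ∀ p q, G.Adj p q → s(p, q) ∉ R → G'.Adj p q := by
  refine ⟨SimpleGraph.fromEdgeSet ((G.edgeSet \ R) ∪ A),
    fun x => by convert degree_exchange G R A hR hA hd h x,
    fun p q hpq => ?_, fun p q hpq hn => ?_⟩
  · rw [SimpleGraph.fromEdgeSet_adj]
    exact ⟨Or.inr hpq, hd _ hpq⟩
  · rw [SimpleGraph.fromEdgeSet_adj]
    exact ⟨Or.inl ⟨hpq, hn⟩, hpq.ne⟩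

/-- Switching along an alternating closed trail of length four. -/
lemma exists_switch_four (G : SimpleGraph V) (a b c d : V) (hab : G.Adj a b) (hcd : G.Adj c d)
    (hbc : ¬ G.Adj b c) (hda : ¬ G.Adj d a) (nbc : b ≠ c) (nda : d ≠ a)
    (nac : a ≠ c) (nbd : b ≠ d) :
    ∃ G' : SimpleGraph V, (∀ x, G'.degree x = G.degree x) ∧ G'.Adj b c ∧ G'.Adj d a ∧
      ∀ p q, G.Adj p q → s(p, q) ≠ s(a, b) → s(p, q) ≠ s(c, d) → G'.Adj p q := by
  obtain ⟨G', h1, h2, h3⟩ := exists_exchange G {s(a, b), s(c, d)} {s(b, c), s(d, a)}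
    (by simp [hab, hcd]) (by simp [hbc, hda]) (by simp [nbc, nda]) (by
      intro x
      rw [Finset.sum_pair (by simp [nac, nda.symm]), Finset.sum_pair (by simp [nbd, hab.ne']),
        ite_mem_sym2 hab.ne, ite_mem_sym2 hcd.ne, ite_mem_sym2 nbc, ite_mem_sym2 nda]
      ring)
  refine ⟨G', h1, h2 _ _ (by simp), h2 _ _ (by simp), fun p q hpq n1 n2 => h3 p q hpq ?_⟩
  rw [Finset.mem_insert, Finset.mem_singleton]
  tauto

/-- Switching along an alternating closed trail of length eight. -/
lemma exists_switch_eight (G : SimpleGraph V) (a b c d e f g h : V)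
    (hab : G.Adj a b) (hcd : G.Adj c d) (hef : G.Adj e f) (hgh : G.Adj g h)
    (hbc : ¬ G.Adj b c) (hde : ¬ G.Adj d e) (hfg : ¬ G.Adj f g) (hha : ¬ G.Adj h a)
    (nbc : b ≠ c) (nde : d ≠ e) (nfg : f ≠ g) (nha : h ≠ a)
    (hR : [s(a, b), s(c, d), s(e, f), s(g, h)].Nodup)
    (hA : [s(b, c), s(d, e), s(f, g), s(h, a)].Nodup) :
    ∃ G' : SimpleGraph V, (∀ x, G'.degree x = G.degree x) ∧
      (G'.Adj b c ∧ G'.Adj d e ∧ G'.Adj f g ∧ G'.Adj h a) ∧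
      ∀ p q, G.Adj p q → s(p, q) ≠ s(a, b) → s(p, q) ≠ s(c, d) → s(p, q) ≠ s(e, f) →
        s(p, q) ≠ s(g, h) → G'.Adj p q := by
  obtain ⟨G', h1, h2, h3⟩ := exists_exchange G {s(a, b), s(c, d), s(e, f), s(g, h)}
    {s(b, c), s(d, e), s(f, g), s(h, a)}
    (by simp [hab, hcd, hef, hgh]) (by simp [hbc, hde, hfg, hha]) (by simp [nbc, nde, nfg, nha]) (by
      intro x
      rw [sum_four _ hR, sum_four _ hA,
        ite_mem_sym2 hab.ne, ite_mem_sym2 hcd.ne, ite_mem_sym2 hef.ne, ite_mem_sym2 hgh.ne,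
        ite_mem_sym2 nbc, ite_mem_sym2 nde, ite_mem_sym2 nfg, ite_mem_sym2 nha]
      ring)
  refine ⟨G', h1, ⟨h2 _ _ (by simp), h2 _ _ (by simp), h2 _ _ (by simp), h2 _ _ (by simp)⟩,
    fun p q hpq n1 n2 n3 n4 => h3 p q hpq ?_⟩
  rw [Finset.mem_insert, Finset.mem_insert, Finset.mem_insert, Finset.mem_singleton]
  tauto

/-- The pair `u, v` has as many common neighbours as possible among all graphs with the degrees
of `G`. -/
def MaxCommon (G : SimpleGraph V) (u v : V) : Prop :=
  ∀ G' : SimpleGraph V, (∀ x, G'.degree x = G.degree x) →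
    (commonNbrs G' u v).card ≤ (commonNbrs G u v).card

lemma MaxCommon.symm {G : SimpleGraph V} {u v : V} (h : MaxCommon G u v) : MaxCommon G v u := by
  intro G' hG'
  rw [commonNbrs_comm G', commonNbrs_comm G]
  exact h G' hG'

lemma MaxCommon.not_exists {G : SimpleGraph V} {u v : V} (h : MaxCommon G u v)
    {G' : SimpleGraph V} (hG' : ∀ x, G'.degree x = G.degree x) {x : V}
    (hx : x ∉ commonNbrs G u v) (hux : G'.Adj u x) (hvx : G'.Adj v x)
    (hsub : commonNbrs G u v ⊆ commonNbrs G' u v) : False := by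
  have h1 : insert x (commonNbrs G u v) ⊆ commonNbrs G' u v :=
    Finset.insert_subset (mem_commonNbrs.2 ⟨hux, hvx⟩) hsub
  have h2 := Finset.card_le_card h1
  rw [Finset.card_insert_of_notMem hx] at h2
  have := h G' hG'
  omega

/-- Otherwise replacing `vc`, `bx` by `cx`, `bv` makes `b` a new common neighbour; none is lost,
because `c` was not one. -/
lemma MaxCommon.adj_right {G : SimpleGraph V} {u v b c : V} (h : MaxCommon G u v)
    (hub : G.Adj u b) (hvb : ¬ G.Adj v b) (nvb : v ≠ b)
    (hvc : G.Adj v c) (huc : ¬ G.Adj u c)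
    {x : V} (hbx : G.Adj b x) (nxu : x ≠ u) (nxc : x ≠ c) : G.Adj c x := by
  by_contra hcx
  have nxv : x ≠ v := by rintro rfl; exact hvb hbx.symm
  have nbc : b ≠ c := by rintro rfl; exact huc hub
  obtain ⟨G', hdeg, -, hbv, hkeep⟩ := exists_switch_four G v c x b hvc hbx.symm hcx
    (fun h => hvb h.symm) nxc.symm nvb.symm nxv.symm nbc.symm
  refine h.not_exists hdeg (x := b) (fun hb => hvb (mem_commonNbrs.1 hb).2) ?_ hbv.symm ?_
  · apply hkeep _ _ hub <;> grind [Sym2.eq_iff, SimpleGraph.Adj.ne]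
  · intro a ha
    obtain ⟨h1, h2⟩ := mem_commonNbrs.1 ha
    refine mem_commonNbrs.2 ⟨hkeep _ _ h1 ?_ ?_, hkeep _ _ h2 ?_ ?_⟩ <;>
      grind [Sym2.eq_iff, SimpleGraph.Adj.ne]

/-- The alternating trail `u b y x v c z x` passes through `x` twice: `x` trades `y`, `z` for `u`,
`v`, while `u` and `v` give up only the private neighbours `b` and `c`. -/
lemma MaxCommon.not_two_free_nbrs {G : SimpleGraph V} {u v b c : V} (h : MaxCommon G u v)
    (huv : u ≠ v) (hub : G.Adj u b) (hvb : ¬ G.Adj v b) (nvb : v ≠ b)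
    (hvc : G.Adj v c) (huc : ¬ G.Adj u c) (nuc : u ≠ c)
    {x y z : V} (nux : u ≠ x) (nvx : v ≠ x) (hux : ¬ G.Adj u x) (hvx : ¬ G.Adj v x)
    (hbx : ¬ G.Adj b x) (hxy : G.Adj x y) (hxz : G.Adj x z) (nyz : y ≠ z)
    (hby : ¬ G.Adj b y) (hcz : ¬ G.Adj c z) (hcx : ¬ G.Adj c x) : False := by
  have nyb : b ≠ y := by rintro rfl; exact hbx hxy.symm
  have nzc : c ≠ z := by rintro rfl; exact hcx hxz.symm
  have nzb : b ≠ z := by rintro rfl; exact hbx hxz.symm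
  have nbx : b ≠ x := by rintro rfl; exact hux hub
  have ncx : c ≠ x := by rintro rfl; exact hvx hvc
  have nyu : y ≠ u := by rintro rfl; exact hux hxy.symm
  have nyv : y ≠ v := by rintro rfl; exact hvx hxy.symm
  have nzu : z ≠ u := by rintro rfl; exact hux hxz.symm
  have nzv : z ≠ v := by rintro rfl; exact hvx hxz.symm
  have nbc : b ≠ c := by rintro rfl; exact huc hub
  have nub := hub.ne
  have nvc := hvc.ne
  have nxy := hxy.ne
  have nxz := hxz.ne
  obtain ⟨G', hdeg, ⟨-, h1, -, h2⟩, hkeep⟩ := exists_switch_eight G u b y x v c z x hub hxy.symm hvc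
    hxz.symm hby (fun h => hvx h.symm) hcz (fun h => hux h.symm) nyb nvx.symm nzc nux.symm
    (by simp; grind) (by simp; grind)
  refine h.not_exists hdeg (x := x) (fun hb => hux (mem_commonNbrs.1 hb).1) h2.symm h1.symm ?_
  intro a ha
  obtain ⟨h1, h2⟩ := mem_commonNbrs.1 ha
  refine mem_commonNbrs.2 ⟨hkeep _ _ h1 ?_ ?_ ?_ ?_, hkeep _ _ h2 ?_ ?_ ?_ ?_⟩ <;>
    grind [Sym2.eq_iff]

/-- The move which makes `x` a common neighbour of two adjacent vertices `v, w` with the help of a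
far edge `pq`. -/
lemma MaxCommon.not_far_edge {G : SimpleGraph V} {v w : V} (h : MaxCommon G v w)
    (hvw : G.Adj v w) {x y z p q : V} (nvx : v ≠ x) (nwx : w ≠ x) (hvx : ¬ G.Adj v x)
    (hwx : ¬ G.Adj w x) (hxy : G.Adj x y) (hxz : G.Adj x z) (nyz : y ≠ z) (hpq : G.Adj p q)
    (nyp : y ≠ p) (hyp : ¬ G.Adj y p) (nzq : z ≠ q) (hzq : ¬ G.Adj z q)
    (nvp : v ≠ p) (nwp : w ≠ p) (nvq : v ≠ q) (nwq : w ≠ q) : False := by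
  have nyv : y ≠ v := by rintro rfl; exact hvx hxy.symm
  have nyw : y ≠ w := by rintro rfl; exact hwx hxy.symm
  have nzv : z ≠ v := by rintro rfl; exact hvx hxz.symm
  have nzw : z ≠ w := by rintro rfl; exact hwx hxz.symm
  have nzp : z ≠ p := by rintro rfl; exact hzq hpq
  have nyq : y ≠ q := by rintro rfl; exact hyp hpq.symm
  have npx : p ≠ x := by rintro rfl; exact hyp hxy.symm
  have nqx : q ≠ x := by rintro rfl; exact hzq hxz.symm
  have n1 := hvw.ne
  have n2 := hpq.ne
  have nxy := hxy.ne
  have nxz := hxz.ne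
  -- The edge `vw` can be sacrificed, since no common neighbour of `v` and `w` depends on it.
  obtain ⟨G', hdeg, ⟨h1, -, -, h2⟩, hkeep⟩ := exists_switch_eight G v w x y p q z x hvw hxy hpq
    hxz.symm hwx hyp (fun h => hzq h.symm) (fun h => hvx h.symm) nwx nyp nzq.symm nvx.symm
    (by simp; grind) (by simp; grind)
  refine h.not_exists hdeg (x := x) (fun hb => hvx (mem_commonNbrs.1 hb).1) h2.symm h1 ?_
  intro a ha
  obtain ⟨h1, h2⟩ := mem_commonNbrs.1 ha
  have n3 := h1.ne
  have n4 := h2.ne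
  refine mem_commonNbrs.2 ⟨hkeep _ _ h1 ?_ ?_ ?_ ?_, hkeep _ _ h2 ?_ ?_ ?_ ?_⟩ <;>
    grind [Sym2.eq_iff]

end Switching

/-! ### Degree-sum bounds derived from maximality. -/

section Counting

open scoped Classical

lemma card_insert_insert_union_le {M : Type*} (u v : M) (A S : Finset M) :
    (insert u (insert v (A ∪ S))).card ≤ A.card + S.card + 2 := by
  have h1 := Finset.card_insert_le u (insert v (A ∪ S))
  have h2 := Finset.card_insert_le v (A ∪ S)
  have h3 := Finset.card_union_le A S
  omega

variable {V : Type*} [Fintype V]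

lemma sum_card_inter_le (G : SimpleGraph V) (X Y : Finset V) :
    ∑ x ∈ X, (G.neighborFinset x ∩ Y).card ≤ ∑ y ∈ Y, G.degree y := by
  have h1 : ∀ x, (G.neighborFinset x ∩ Y).card = ∑ y ∈ Y, if G.Adj x y then 1 else 0 := by
    intro x
    rw [← Finset.card_filter]
    congr 1
    ext y
    simp [and_comm]
  simp only [h1]
  rw [Finset.sum_comm]
  refine Finset.sum_le_sum fun y _ => ?_
  rw [← Finset.card_filter, ← SimpleGraph.card_neighborFinset_eq_degree]
  refine Finset.card_le_card fun x hx => ?_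
  simpa using (Finset.mem_filter.1 hx).2.symm

lemma sum_degree_le_of_exception (G : SimpleGraph V) {t : V} {Δ M : ℕ}
    (h : ∀ x, x ≠ t → G.degree x ≤ Δ) (ht : G.degree t ≤ M) (X : Finset V) :
    ∑ x ∈ X, G.degree x ≤ X.card * Δ + M := by
  calc ∑ x ∈ X, G.degree x ≤ ∑ x ∈ X, (Δ + if x = t then M else 0) := by
        refine Finset.sum_le_sum fun x _ => ?_
        by_cases hx : x = t
        · subst hx; simp; omega
        · simpa [hx] using h x hx
    _ ≤ X.card * Δ + M := by
        rw [Finset.sum_add_distrib, Finset.sum_const, smul_eq_mul, Finset.sum_ite_eq']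
        split_ifs <;> omega

/-- Each vertex of `W` has at most `W.card - 1` neighbours inside; the edges leaving `W` are charged
to their outer ends. -/
lemma sum_degree_le_sq_add (G : SimpleGraph V) (W : Finset V) :
    ∑ x ∈ W, G.degree x + W.card ≤ W.card * W.card + ∑ x ∈ Wᶜ, G.degree x := by
  have h1 : ∀ x ∈ W, G.degree x + 1 ≤ W.card + (G.neighborFinset x ∩ Wᶜ).card := by
    intro x hx
    rw [← SimpleGraph.card_neighborFinset_eq_degree,
      ← Finset.card_inter_add_card_sdiff (G.neighborFinset x) W, Finset.sdiff_eq_inter_compl]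
    have : (G.neighborFinset x ∩ W).card < W.card := by
      refine Finset.card_lt_card ⟨Finset.inter_subset_right, fun hh => ?_⟩
      simpa using hh hx
    omega
  have h2 := Finset.sum_le_sum h1
  rw [Finset.sum_add_distrib, Finset.sum_add_distrib] at h2
  have h3 := sum_card_inter_le G W Wᶜ
  simp only [Finset.sum_const, smul_eq_mul, mul_one] at h2
  omega

/-- A vertex `b` adjacent to `u` only and a vertex `c` adjacent to `v` only, where the number of
common neighbours of `u` and `v` cannot be increased. -/
structure PrivatePair (G : SimpleGraph V) (u v b c : V) : Prop where
  max : MaxCommon G u v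
  ne : u ≠ v
  hub : G.Adj u b
  hvb : ¬ G.Adj v b
  nvb : v ≠ b
  hvc : G.Adj v c
  huc : ¬ G.Adj u c
  nuc : u ≠ c

namespace PrivatePair

variable {G : SimpleGraph V} {u v b c : V}

lemma symm (h : PrivatePair G u v b c) : PrivatePair G v u c b :=
  ⟨h.max.symm, h.ne.symm, h.hvc, h.huc, h.nuc, h.hub, h.hvb, h.nvb⟩

lemma adj_right (h : PrivatePair G u v b c) {x : V} (hbx : G.Adj b x) (nxu : x ≠ u)
    (nxc : x ≠ c) : G.Adj c x :=
  h.max.adj_right h.hub h.hvb h.nvb h.hvc h.huc hbx nxu nxc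

lemma adj_left (h : PrivatePair G u v b c) {x : V} (hcx : G.Adj c x) (nxv : x ≠ v)
    (nxb : x ≠ b) : G.Adj b x :=
  h.symm.adj_right hcx nxv nxb

lemma change_left (h : PrivatePair G u v b c) {b' : V} (hub : G.Adj u b') (hvb : ¬ G.Adj v b')
    (nvb : v ≠ b') : PrivatePair G u v b' c :=
  ⟨h.max, h.ne, hub, hvb, nvb, h.hvc, h.huc, h.nuc⟩

/-- Any private neighbour of `u` may play the role of `b`, so it inherits the neighbours of `c`. -/
lemma left_adj_of_mem (h : PrivatePair G u v b c) {b' s : V} (hub : G.Adj u b')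
    (hvb : ¬ G.Adj v b') (nvb : v ≠ b') (hs : s ∈ commonNbrs G b c) (ns : s ≠ b') :
    G.Adj s b' := by
  obtain ⟨h1, h2⟩ := mem_commonNbrs.1 hs
  refine ((h.change_left hub hvb nvb).adj_left h2 ?_ ns).symm
  rintro rfl
  exact h.hvb h1.symm

lemma sdiff_subset_left (h : PrivatePair G u v b c) :
    G.neighborFinset b \ commonNbrs G b c ⊆ {u, c} := by
  intro x hx
  rw [Finset.mem_sdiff, SimpleGraph.mem_neighborFinset, mem_commonNbrs] at hx
  by_contra hn
  simp only [Finset.mem_insert, Finset.mem_singleton, not_or] at hn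
  exact hx.2 ⟨hx.1, h.adj_right hx.1 hn.1 hn.2⟩

lemma card_sdiff_left (h : PrivatePair G u v b c) :
    (G.neighborFinset b \ commonNbrs G b c).card ≤ 2 :=
  (Finset.card_le_card h.sdiff_subset_left).trans Finset.card_le_two

/-- With `x` in the role of `b`, a neighbour `y ≠ u` passes to `c`, and from `c` back to `b`, so it
would be common to both. -/
lemma eq_of_private_left (h : PrivatePair G u v b c) {x y : V} (hux : G.Adj u x)
    (hvx : ¬ G.Adj v x) (nvx : v ≠ x) (nxb : x ≠ b) (hxS : x ∉ commonNbrs G b c)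
    (hxy : G.Adj x y) (hyS : y ∉ commonNbrs G b c) : y = u := by
  by_contra nyu
  rw [mem_commonNbrs] at hxS hyS
  have nxu := hux.ne'
  have nxc : x ≠ c := by rintro rfl; exact h.huc hux
  have nyv : y ≠ v := by rintro rfl; exact hvx hxy.symm
  have hbx : ¬ G.Adj b x := fun hb => hxS ⟨hb, h.adj_right hb nxu nxc⟩
  have hcx : ¬ G.Adj c x := fun hc => hbx (h.adj_left hc nvx.symm nxb)
  have nyb : y ≠ b := by rintro rfl; exact hbx hxy.symm
  have nyc : y ≠ c := by rintro rfl; exact hcx hxy.symm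
  have hcy := (h.change_left hux hvx nvx).adj_right hxy nyu nyc
  exact hyS ⟨h.adj_left hcy nyv nyb, hcy⟩

/-- The vertices `u`, `v`, their common neighbours, and the common neighbours of `b` and `c`. -/
noncomputable def core (G : SimpleGraph V) (u v b c : V) : Finset V :=
  insert u (insert v (commonNbrs G u v ∪ commonNbrs G b c))

lemma mem_core {x : V} : x ∈ core G u v b c ↔
    x = u ∨ x = v ∨ x ∈ commonNbrs G u v ∨ x ∈ commonNbrs G b c := by
  simp [core]

lemma card_sdiff_le_one (h : PrivatePair G u v b c) {x : V} (hx : x ∉ core G u v b c)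
    (nxb : x ≠ b) (nxc : x ≠ c) : (G.neighborFinset x \ commonNbrs G b c).card ≤ 1 := by
  simp only [mem_core, not_or] at hx
  obtain ⟨nxu, nxv, hxA, hxS⟩ := hx
  rw [Finset.card_le_one]
  intro y hy z hz
  rw [Finset.mem_sdiff, SimpleGraph.mem_neighborFinset] at hy hz
  by_cases hux : G.Adj u x
  · have hvx : ¬ G.Adj v x := fun hv => hxA (mem_commonNbrs.2 ⟨hux, hv⟩)
    rw [h.eq_of_private_left hux hvx (Ne.symm nxv) nxb hxS hy.1 hy.2,
      h.eq_of_private_left hux hvx (Ne.symm nxv) nxb hxS hz.1 hz.2]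
  by_cases hvx : G.Adj v x
  · have e := commonNbrs_comm G b c
    rw [e] at hxS hy hz
    rw [h.symm.eq_of_private_left hvx hux (Ne.symm nxu) nxc hxS hy.1 hy.2,
      h.symm.eq_of_private_left hvx hux (Ne.symm nxu) nxc hxS hz.1 hz.2]
  -- Here `x` is adjacent to neither `u` nor `v`, so two neighbours outside `S` permit the switch of
  -- length eight.
  by_contra nyz
  rw [mem_commonNbrs] at hxS hy hz
  have hbx : ¬ G.Adj b x := fun hb => hxS ⟨hb, h.adj_right hb nxu nxc⟩
  have hcx : ¬ G.Adj c x := fun hc => hbx (h.adj_left hc nxv nxb)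
  refine h.max.not_two_free_nbrs h.ne h.hub h.hvb h.nvb h.hvc h.huc h.nuc (Ne.symm nxu)
    (Ne.symm nxv) hux hvx hbx hy.1 hz.1 nyz ?_ ?_ hcx
  · intro hby
    refine hy.2 ⟨hby, h.adj_right hby ?_ ?_⟩
    · rintro rfl; exact hux hy.1.symm
    · rintro rfl; exact hcx hy.1.symm
  · intro hcz
    refine hz.2 ⟨h.adj_left hcz ?_ ?_, hcz⟩
    · rintro rfl; exact hvx hz.1.symm
    · rintro rfl; exact hbx hz.1.symm

lemma sum_compl_core_le (h : PrivatePair G u v b c) :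
    ∑ x ∈ (core G u v b c)ᶜ, G.degree x ≤
      ∑ x ∈ (core G u v b c)ᶜ, (G.neighborFinset x ∩ commonNbrs G b c).card +
        (core G u v b c)ᶜ.card + 2 := by
  have h1 : ∀ x ∈ (core G u v b c)ᶜ, G.degree x ≤
      (G.neighborFinset x ∩ commonNbrs G b c).card +
        (1 + ((if x = b then 1 else 0) + if x = c then 1 else 0)) := by
    intro x hx
    rw [Finset.mem_compl] at hx
    rw [← SimpleGraph.card_neighborFinset_eq_degree,
      ← Finset.card_inter_add_card_sdiff (G.neighborFinset x) (commonNbrs G b c)]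
    refine Nat.add_le_add_left ?_ _
    by_cases hb : x = b
    · subst hb
      have := h.card_sdiff_left
      simp only [if_true]; omega
    by_cases hc : x = c
    · subst hc
      have := h.symm.card_sdiff_left
      rw [commonNbrs_comm] at this
      simp only [if_true]; omega
    have := h.card_sdiff_le_one hx hb hc
    omega
  refine (Finset.sum_le_sum h1).trans ?_
  rw [Finset.sum_add_distrib, Finset.sum_add_distrib, Finset.sum_add_distrib, Finset.sum_ite_eq',
    Finset.sum_ite_eq', Finset.sum_const, smul_eq_mul, mul_one]
  split_ifs <;> omega

lemma sum_degree_le_of_card_le_one (h : PrivatePair G u v b c)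
    (hA : (commonNbrs G u v).card ≤ 4) (hS : (commonNbrs G b c).card ≤ 1)
    (hn : 7 ≤ Fintype.card V) : ∑ x, G.degree x ≤ 4 * Fintype.card V + 18 := by
  have h1 := h.sum_compl_core_le
  have h2 : ∑ x ∈ (core G u v b c)ᶜ, (G.neighborFinset x ∩ commonNbrs G b c).card ≤
      ∑ x ∈ (core G u v b c)ᶜ, 1 :=
    Finset.sum_le_sum fun x _ => (Finset.card_le_card Finset.inter_subset_right).trans hS
  rw [Finset.sum_const, smul_eq_mul, mul_one] at h2
  have h3 := sum_degree_le_sq_add G (core G u v b c)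
  have h4 : (core G u v b c).card ≤ _ :=
    card_insert_insert_union_le u v (commonNbrs G u v) (commonNbrs G b c)
  have h5 := Finset.card_compl (core G u v b c)
  rw [← Finset.sum_add_sum_compl (core G u v b c)]
  generalize (core G u v b c).card = w at *
  have h6 : w ≤ 7 := by omega
  -- The bound is quadratic in the core size `w`: the excess over `4n` is `w² - 5w + 4`, largest at
  -- `w = 7`.
  interval_cases w <;> omega

lemma sum_degree_le_of_exception (h : PrivatePair G u v b c)
    (hA : (commonNbrs G u v).card ≤ 4) (hS : (commonNbrs G b c).card ≤ 4)
    {t : V} {Δ M : ℕ} (hΔ : 0 < Δ) (hd : ∀ x, x ≠ t → G.degree x ≤ Δ) (ht : G.degree t ≤ M) :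
    ∑ x, G.degree x + 8 ≤ 14 * Δ + 2 * M + Fintype.card V := by
  have h1 := h.sum_compl_core_le
  have h2 := sum_card_inter_le G (core G u v b c)ᶜ (commonNbrs G b c)
  have h3 := _root_.sum_degree_le_of_exception G hd ht (commonNbrs G b c)
  have h4 := _root_.sum_degree_le_of_exception G hd ht (core G u v b c)
  have h5 : (core G u v b c).card ≤ _ :=
    card_insert_insert_union_le u v (commonNbrs G u v) (commonNbrs G b c)
  have h6 := Finset.card_add_card_compl (core G u v b c)
  rw [← Finset.sum_add_sum_compl (core G u v b c)]
  -- A core vertex costs up to `Δ`, an outer one the base cost 1. Writing `Δ = δ + 1` makes the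
  -- total increase with the core size, which is at most 10.
  obtain ⟨δ, rfl⟩ : ∃ δ, Δ = δ + 1 := ⟨Δ - 1, by omega⟩
  have h7 : (commonNbrs G b c).card * (δ + 1) ≤ 4 * (δ + 1) := Nat.mul_le_mul_right _ hS
  have h8 : (core G u v b c).card * δ ≤ 10 * δ := Nat.mul_le_mul_right _ (by omega)
  rw [mul_add, mul_one] at h4
  omega

/-- The vertices adjacent to exactly one of `u` and `v` are few if `b` and `c` have two common
neighbours. -/
lemma card_private_le (h : PrivatePair G u v b c)
    (hfree : ∀ p q, p ≠ q → (commonNbrs G p q).card ≤ 4) (hS : 2 ≤ (commonNbrs G b c).card) :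
    (G.neighborFinset u \ insert v (commonNbrs G u v)).card +
      (G.neighborFinset v \ insert u (commonNbrs G u v)).card ≤ 6 := by
  obtain ⟨p, hp, q, hq, hpq⟩ := Finset.one_lt_card.1 hS
  have hdis : Disjoint (G.neighborFinset u \ insert v (commonNbrs G u v))
      (G.neighborFinset v \ insert u (commonNbrs G u v)) := by
    rw [Finset.disjoint_left]
    intro x hx hx'
    simp only [Finset.mem_sdiff, SimpleGraph.mem_neighborFinset, Finset.mem_insert,
      mem_commonNbrs] at hx hx'
    tauto
  -- Every private vertex other than `p`, `q` is a common neighbour of `p` and `q`, hence the bound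
  -- `4 + 2`.
  have hsub : (G.neighborFinset u \ insert v (commonNbrs G u v)) ∪
      (G.neighborFinset v \ insert u (commonNbrs G u v)) ⊆
        insert p (insert q (commonNbrs G p q)) := by
    intro x hx
    simp only [Finset.mem_union, Finset.mem_sdiff, SimpleGraph.mem_neighborFinset,
      Finset.mem_insert, mem_commonNbrs, not_or, not_and] at hx ⊢
    by_cases nxp : x = p
    · exact Or.inl nxp
    by_cases nxq : x = q
    · exact Or.inr (Or.inl nxq)
    refine Or.inr (Or.inr ?_)
    rcases hx with ⟨h1, h2, h3⟩ | ⟨h1, h2, h3⟩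
    · have h4 := h3 h1
      exact ⟨h.left_adj_of_mem h1 h4 (Ne.symm h2) hp (Ne.symm nxp),
        h.left_adj_of_mem h1 h4 (Ne.symm h2) hq (Ne.symm nxq)⟩
    · have h4 : ¬ G.Adj u x := fun h5 => h3 h5 h1
      rw [commonNbrs_comm] at hp hq
      exact ⟨h.symm.left_adj_of_mem h1 h4 (Ne.symm h2) hp (Ne.symm nxp),
        h.symm.left_adj_of_mem h1 h4 (Ne.symm h2) hq (Ne.symm nxq)⟩
  rw [← Finset.card_union_of_disjoint hdis]
  have h1 := Finset.card_le_card hsub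
  have h2 := Finset.card_insert_le p (insert q (commonNbrs G p q))
  have h3 := Finset.card_insert_le q (commonNbrs G p q)
  have h4 := hfree p q hpq
  omega

end PrivatePair

/-- The final 1 allows for `v` itself being a neighbour of `u`. -/
lemma degree_le_card_private (G : SimpleGraph V) (u v : V) :
    G.degree u ≤ (G.neighborFinset u \ insert v (commonNbrs G u v)).card +
      (commonNbrs G u v).card + 1 := by
  rw [← SimpleGraph.card_neighborFinset_eq_degree]
  have h1 := Finset.card_le_card_sdiff_add_card (t := insert v (commonNbrs G u v))
    (s := G.neighborFinset u)
  have h2 := Finset.card_insert_le v (commonNbrs G u v)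
  omega

end Counting

/-! ### Existence of a realization containing `K_{2,5}`. -/

section Existence

open scoped Classical

variable {V : Type*} [Fintype V]

lemma exists_maxCommon (G₀ : SimpleGraph V) (u v : V) :
    ∃ G : SimpleGraph V, (∀ x, G.degree x = G₀.degree x) ∧ MaxCommon G u v := by
  have := Fintype.ofFinite (SimpleGraph V)
  obtain ⟨G, hG, hmax⟩ := Finset.exists_max_image
    (Finset.univ.filter fun G : SimpleGraph V => ∀ x, G.degree x = G₀.degree x)
    (fun G => (commonNbrs G u v).card) ⟨G₀, by simp⟩
  simp only [Finset.mem_filter, Finset.mem_univ, true_and] at hG hmax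
  exact ⟨G, hG, fun G' hG' => hmax G' fun x => (hG' x).trans (hG x)⟩

lemma exists_privatePair {G : SimpleGraph V} {u v : V} (h : MaxCommon G u v) (huv : u ≠ v)
    (hu : (G.neighborFinset u \ insert v (commonNbrs G u v)).Nonempty)
    (hv : (G.neighborFinset v \ insert u (commonNbrs G u v)).Nonempty) :
    ∃ b c, PrivatePair G u v b c := by
  obtain ⟨b, hb⟩ := hu
  obtain ⟨c, hc⟩ := hv
  simp only [Finset.mem_sdiff, SimpleGraph.mem_neighborFinset, Finset.mem_insert, mem_commonNbrs,
    not_or, not_and] at hb hc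
  exact ⟨b, c, h, huv, hb.1, hb.2.2 hb.1, Ne.symm hb.2.1, hc.1, fun h' => hc.2.2 h' hc.1,
    Ne.symm hc.2.1⟩

/-- A large degree sum forces five common neighbours when the second largest degree is at
least six. -/
lemma exists_five_common_of_six_le (G₀ : SimpleGraph V) {u v : V} (huv : u ≠ v)
    (hle : G₀.degree v ≤ G₀.degree u) (hd : ∀ x, x ≠ u → G₀.degree x ≤ G₀.degree v)
    (h6 : 6 ≤ G₀.degree v) (hn : 37 ≤ Fintype.card V)
    (hs : 5 * Fintype.card V ≤ ∑ x, G₀.degree x + 3) :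
    ∃ G : SimpleGraph V, (∀ x, G.degree x = G₀.degree x) ∧
      ∃ p q, p ≠ q ∧ 5 ≤ (commonNbrs G p q).card := by
  obtain ⟨G, hG, hmax⟩ := exists_maxCommon G₀ u v
  simp only [← hG] at hle hd h6 hs
  refine ⟨G, hG, ?_⟩
  by_contra! hno
  have hfree : ∀ p q, p ≠ q → (commonNbrs G p q).card ≤ 4 := fun p q hpq => by
    have := hno p q hpq
    omega
  have hA := hfree u v huv
  have hu := degree_le_card_private G u v
  have hv := degree_le_card_private G v u
  rw [commonNbrs_comm G v u] at hv
  obtain ⟨b, c, h⟩ := exists_privatePair hmax huv (Finset.card_pos.1 (by omega))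
    (Finset.card_pos.1 (by omega))
  have hS : (commonNbrs G b c).card ≤ 4 := hfree b c (by rintro rfl; exact h.huc h.hub)
  rcases Nat.lt_or_ge (commonNbrs G b c).card 2 with h1 | h2
  · have := h.sum_degree_le_of_card_le_one hA (by omega) (by omega)
    omega
  · have h3 := h.card_private_le hfree h2
    -- At most six private vertices give `deg u + deg v ≤ 6 + 2 * 5`, so the smaller degree is at
    -- most 8. As `v` has a private vertex, `u` has at most five, so `deg u ≤ 5 + 4 + 1`.
    have := h.sum_degree_le_of_exception hA hS (t := u) (Δ := 8) (M := 10) (by norm_num)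
      (fun x hx => (hd x hx).trans (by omega)) (by
        have : 0 < (G.neighborFinset v \ insert u (commonNbrs G u v)).card := by omega
        omega)
    omega

/-- A large degree sum forces five common neighbours when all degrees but one are at most five. -/
lemma exists_five_common_of_le_five (G₀ : SimpleGraph V) {t v w : V} (hvw : v ≠ w)
    (hd : ∀ x, x ≠ t → G₀.degree x ≤ 5) (hv5 : G₀.degree v = 5) (hw5 : G₀.degree w = 5)
    (hn : 37 ≤ Fintype.card V)
    (hs : 5 * Fintype.card V ≤ ∑ x, G₀.degree x + 3) :
    ∃ G : SimpleGraph V, (∀ x, G.degree x = G₀.degree x) ∧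
      ∃ p q, p ≠ q ∧ 5 ≤ (commonNbrs G p q).card := by
  obtain ⟨G, hG, hmax⟩ := exists_maxCommon G₀ v w
  simp only [← hG] at hd hv5 hw5 hs
  refine ⟨G, hG, ?_⟩
  by_contra! hno
  have hfree : ∀ p q, p ≠ q → (commonNbrs G p q).card ≤ 4 := fun p q hpq => by
    have := hno p q hpq
    omega
  have hA := hfree v w hvw
  have ht : G.degree t ≤ Fintype.card V - 1 := by
    have := G.degree_lt_card_verts t
    omega
  have hv := degree_le_card_private G v w
  have hw := degree_le_card_private G w v
  rw [commonNbrs_comm G w v] at hw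
  by_cases hne : (G.neighborFinset v \ insert w (commonNbrs G v w)).Nonempty ∧
      (G.neighborFinset w \ insert v (commonNbrs G v w)).Nonempty
  · obtain ⟨b, c, h⟩ := exists_privatePair hmax hvw hne.1 hne.2
    have hS : (commonNbrs G b c).card ≤ 4 := hfree b c (by rintro rfl; exact h.huc h.hub)
    have := h.sum_degree_le_of_exception hA hS (by norm_num) hd ht
    omega
  -- Nonadjacent vertices of degree 5 with at most four common neighbours would both have private
  -- neighbours.
  have hadj : G.Adj v w := by
    by_contra hadj
    have key : ∀ p q, G.degree p = 5 → ¬ G.Adj p q → (commonNbrs G p q).card ≤ 4 →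
        (G.neighborFinset p \ insert q (commonNbrs G p q)).Nonempty := by
      intro p q hp hpq hc
      by_contra hn
      rw [Finset.not_nonempty_iff_eq_empty, Finset.sdiff_eq_empty_iff_subset] at hn
      have : G.neighborFinset p ⊆ commonNbrs G p q := by
        intro x hx
        rcases Finset.mem_insert.1 (hn hx) with rfl | h
        · exact absurd ((G.mem_neighborFinset _ _).1 hx) hpq
        · exact h
      have := Finset.card_le_card this
      rw [SimpleGraph.card_neighborFinset_eq_degree] at this
      omega
    refine hne ⟨key v w hv5 hadj hA, ?_⟩
    have := key w v hw5 (fun h => hadj h.symm)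
    rw [commonNbrs_comm G w v] at this
    exact this hA
  -- Whichever endpoint lacks private neighbours, degree 5 forces exactly four common neighbours,
  -- and these with the edge `vw` exhaust the other endpoint's degree too.
  have hcov : ∀ x, G.Adj v x ∨ G.Adj w x →
      x ∈ insert v (insert w (commonNbrs G v w)) := by
    have key : ∀ p q, G.Adj p q → G.degree p = 5 → G.degree q = 5 →
        (commonNbrs G p q).card ≤ 4 →
        ¬ (G.neighborFinset p \ insert q (commonNbrs G p q)).Nonempty →
        ∀ x, G.Adj p x ∨ G.Adj q x → x ∈ insert p (insert q (commonNbrs G p q)) := by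
      intro p q hpq hp hq hc hn x hx
      rw [Finset.not_nonempty_iff_eq_empty, Finset.sdiff_eq_empty_iff_subset] at hn
      have h1 := Finset.card_le_card hn
      rw [SimpleGraph.card_neighborFinset_eq_degree] at h1
      have h2 := Finset.card_insert_le q (commonNbrs G p q)
      have hsub : insert p (commonNbrs G p q) ⊆ G.neighborFinset q := by
        intro y hy
        rcases Finset.mem_insert.1 hy with rfl | h
        · simpa using hpq.symm
        · simpa using (mem_commonNbrs.1 h).2
      have h3 := Finset.eq_of_subset_of_card_le hsub (by
        rw [SimpleGraph.card_neighborFinset_eq_degree, Finset.card_insert_of_notMem]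
        · omega
        · intro h
          exact (mem_commonNbrs.1 h).1.ne rfl)
      rcases hx with hx | hx
      · exact Finset.mem_insert_of_mem (hn (by simpa using hx))
      · have : x ∈ G.neighborFinset q := by simpa using hx
        rw [← h3] at this
        rcases Finset.mem_insert.1 this with rfl | h
        · simp
        · simp [h]
    intro x hx
    by_cases h1 : (G.neighborFinset v \ insert w (commonNbrs G v w)).Nonempty
    · have := key w v hadj.symm hw5 hv5 (by rwa [commonNbrs_comm])
        (by rw [commonNbrs_comm]; exact fun h2 => hne ⟨h1, h2⟩) x hx.symm
      rwa [commonNbrs_comm, Finset.insert_comm] at this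
    · exact key v w hadj hv5 hw5 hA h1 x hx
  -- Otherwise all but at most seven vertices have degree at most 2. Avoiding `t` keeps the
  -- neighbourhoods of `y` and `z` small.
  obtain ⟨x, hxW, hxt⟩ : ∃ x, x ∉ insert t (insert v (insert w (commonNbrs G v w))) ∧
      1 < (G.neighborFinset x \ {t}).card := by
    by_contra! hx
    have h1 := sum_degree_le_of_exception G hd ht
      (insert t (insert v (insert w (commonNbrs G v w))))
    have h2 : ∑ x ∈ (insert t (insert v (insert w (commonNbrs G v w))))ᶜ, G.degree x ≤
        ∑ x ∈ (insert t (insert v (insert w (commonNbrs G v w))))ᶜ, 2 := by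
      refine Finset.sum_le_sum fun x hx' => ?_
      have h3 := hx x (Finset.mem_compl.1 hx')
      have h4 := Finset.card_le_card_sdiff_add_card (s := G.neighborFinset x) (t := {t})
      rw [SimpleGraph.card_neighborFinset_eq_degree, Finset.card_singleton] at h4
      omega
    rw [Finset.sum_const, smul_eq_mul] at h2
    have h3 := Finset.card_add_card_compl (insert t (insert v (insert w (commonNbrs G v w))))
    have h4 := Finset.card_insert_le t (insert v (insert w (commonNbrs G v w)))
    have h5 := Finset.card_insert_le v (insert w (commonNbrs G v w))
    have h6 := Finset.card_insert_le w (commonNbrs G v w)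
    rw [← Finset.sum_add_sum_compl (insert t (insert v (insert w (commonNbrs G v w))))] at hs
    omega
  obtain ⟨y, hy, z, hz, nyz⟩ := Finset.one_lt_card.1 hxt
  simp only [Finset.mem_sdiff, SimpleGraph.mem_neighborFinset, Finset.mem_singleton] at hy hz
  have hcard : ∀ y, y ≠ t →
      (insert t (insert v (insert w (insert y (G.neighborFinset y))))).card ≤ 9 := by
    intro y hy
    have h1 := hd y hy
    rw [← SimpleGraph.card_neighborFinset_eq_degree] at h1
    have h2 := Finset.card_insert_le t (insert v (insert w (insert y (G.neighborFinset y))))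
    have h3 := Finset.card_insert_le v (insert w (insert y (G.neighborFinset y)))
    have h4 := Finset.card_insert_le w (insert y (G.neighborFinset y))
    have h5 := Finset.card_insert_le y (G.neighborFinset y)
    omega
  set P := insert t (insert v (insert w (insert y (G.neighborFinset y)))) with hP
  set Q := insert t (insert v (insert w (insert z (G.neighborFinset z)))) with hQ
  -- Otherwise every edge leaving a vertex outside `P` ends in `Q`, so the degrees in `P` and `Q`
  -- alone bound the whole sum.
  obtain ⟨p, hp, q, hq, hpq⟩ : ∃ p, p ∉ P ∧ ∃ q, q ∉ Q ∧ G.Adj p q := by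
    by_contra! hx
    have h1 : ∑ x ∈ Pᶜ, G.degree x ≤ ∑ x ∈ Pᶜ, (G.neighborFinset x ∩ Q).card := by
      refine Finset.sum_le_sum fun p hp => ?_
      rw [← SimpleGraph.card_neighborFinset_eq_degree]
      refine Finset.card_le_card fun q hq => Finset.mem_inter.2 ⟨hq, ?_⟩
      by_contra hqQ
      exact hx p (Finset.mem_compl.1 hp) q hqQ (by simpa using hq)
    have h2 := h1.trans (sum_card_inter_le G Pᶜ Q)
    have h3 := sum_degree_le_of_exception G hd ht P
    have h4 := sum_degree_le_of_exception G hd ht Q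
    have h5 : P.card ≤ 9 := hcard y hy.2
    have h6 : Q.card ≤ 9 := hcard z hz.2
    rw [← Finset.sum_add_sum_compl P] at hs
    omega
  simp only [hP, hQ, Finset.mem_insert, SimpleGraph.mem_neighborFinset, not_or] at hp hq
  have hx1 : ¬ (G.Adj v x ∨ G.Adj w x) := fun h => hxW (Finset.mem_insert_of_mem (hcov x h))
  simp only [Finset.mem_insert, not_or] at hxW hx1
  exact hmax.not_far_edge hadj (Ne.symm hxW.2.1) (Ne.symm hxW.2.2.1) hx1.1 hx1.2 hy.1 hz.1 nyz hpq
    (Ne.symm hp.2.2.2.1) hp.2.2.2.2 (Ne.symm hq.2.2.2.1) hq.2.2.2.2 (Ne.symm hp.2.1)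
    (Ne.symm hp.2.2.1) (Ne.symm hq.2.1) (Ne.symm hq.2.2.1)

lemma completeBipartiteGraph_two_isContained {G : SimpleGraph V} {u v : V} {k : ℕ} (huv : u ≠ v)
    (h : k ≤ (commonNbrs G u v).card) :
    (completeBipartiteGraph (Fin 2) (Fin k)).IsContained G := by
  have hle : Fintype.card (Fin k) ≤ Fintype.card (commonNbrs G u v) := by simpa using h
  obtain ⟨e⟩ := Function.Embedding.nonempty_of_card_le hle
  have he := fun i => mem_commonNbrs.1 (e i).2
  let f : Fin 2 ⊕ Fin k → V := Sum.elim ![u, v] fun i => (e i : V)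
  have hadj : ∀ i j, G.Adj (f (Sum.inl i)) (f (Sum.inr j)) := by
    intro i j
    fin_cases i
    · exact (he j).1
    · exact (he j).2
  refine ⟨⟨⟨f, ?_⟩, ?_⟩⟩
  · rintro (a | a) (b | b) hab
    · simp at hab
    · exact hadj a b
    · exact (hadj b a).symm
    · simp at hab
  · refine Function.Injective.sumElim ?_ ?_ fun i j => (hadj i j).ne
    · intro i j hij
      fin_cases i <;> fin_cases j <;> simp_all
    · exact fun i j hij => e.injective (Subtype.ext hij)

lemma exists_five_common_of_antitone {n : ℕ} (hn : 37 ≤ n) (G₀ : SimpleGraph (Fin n))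
    (hanti : Antitone fun i => G₀.degree i) (hs : 5 * n ≤ ∑ x, G₀.degree x + 3) :
    ∃ G : SimpleGraph (Fin n), (∀ x, G.degree x = G₀.degree x) ∧
      ∃ p q, p ≠ q ∧ 5 ≤ (commonNbrs G p q).card := by
  obtain ⟨m, rfl⟩ : ∃ m, n = m + 2 := ⟨n - 2, by omega⟩
  have h0 := G₀.degree_lt_card_verts 0
  rw [Fintype.card_fin] at h0
  have h01 : G₀.degree 1 ≤ G₀.degree 0 := hanti (Fin.zero_le _)
  have h1 : ∀ x, x ≠ 0 → G₀.degree x ≤ G₀.degree 1 := fun x hx =>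
    hanti (Fin.one_le_of_ne_zero hx)
  rcases Nat.lt_or_ge 5 (G₀.degree 1) with h6 | h5
  · exact exists_five_common_of_six_le G₀ (u := 0) (v := 1) (by simp) h01 h1 h6
      (by simpa using hn) (by simpa using hs)
  · have hm : 2 < m + 2 := by omega
    have h2 : ∀ x : Fin (m + 2), x ≠ 0 → x ≠ 1 → G₀.degree x ≤ G₀.degree ⟨2, hm⟩ := by
      intro x hx0 hx1
      refine hanti (Fin.le_def.2 ?_)
      have h3 : x.val ≠ 0 := fun h => hx0 (Fin.ext h)
      have h4 : x.val ≠ 1 := fun h => hx1 (Fin.ext h)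
      show 2 ≤ x.val
      omega
    have h21 : G₀.degree ⟨2, hm⟩ ≤ G₀.degree 1 := h1 _ (by simp [Fin.ext_iff])
    -- Otherwise the sum is at most `(n - 1) + 5 + 4(n - 2) = 5n - 4`.
    have h25 : 5 ≤ G₀.degree ⟨2, hm⟩ := by
      by_contra! hlt
      have h3 : ∑ i : Fin m, G₀.degree i.succ.succ ≤ ∑ i : Fin m, 4 := by
        refine Finset.sum_le_sum fun i _ => (h2 _ (Fin.succ_ne_zero _) ?_).trans (by omega)
        simp [Fin.ext_iff]
      rw [Fin.sum_univ_succ, Fin.sum_univ_succ] at hs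
      simp only [Finset.sum_const, Finset.card_univ, Fintype.card_fin, smul_eq_mul] at h3
      have h4 : G₀.degree (Fin.succ (0 : Fin (m + 1))) = G₀.degree 1 := rfl
      omega
    exact exists_five_common_of_le_five G₀ (t := 0) (v := 1) (w := ⟨2, hm⟩)
      (by simp [Fin.ext_iff]) (fun x hx => (h1 x hx).trans h5) (by omega) (by omega)
      (by simpa using hn) (by simpa using hs)

lemma isPotentiallyGraphic_two_five {n : ℕ} (hn : 37 ≤ n) {d : Fin n → ℕ} (hd : IsGraphic d)
    (hs : 5 * n ≤ ∑ i, d i + 3) :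
    IsPotentiallyGraphic (completeBipartiteGraph (Fin 2) (Fin 5)) d := by
  obtain ⟨hanti, G₀, hG₀⟩ := hd
  have hG₀' : ∀ i, G₀.degree i = d i := fun i => by convert hG₀ i
  obtain ⟨G, hG, p, q, hpq, h5⟩ := exists_five_common_of_antitone hn G₀
    (by simpa only [hG₀'] using hanti) (by simpa only [hG₀'] using hs)
  refine ⟨hanti, G, fun i => ?_, completeBipartiteGraph_two_isContained hpq h5⟩
  convert (hG i).trans (hG₀' i)

end Existence

/-! ### The extremal graph and its degrees. -/

section LowerBound

open scoped Classical

/-- A cone, with apex `0`, over the cycle `1, …, n - 1` together with chords which match opposite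
vertices; the vertex `1` lies on two chords when the cycle is odd. -/
def chordedWheel (n : ℕ) : SimpleGraph (Fin n) :=
  SimpleGraph.fromRel fun i j =>
    i.val = 0 ∨ i.val + 1 = j.val ∨ (i.val = 1 ∧ j.val + 1 = n) ∨
      (0 < i.val ∧ i.val + n / 2 = j.val) ∨ (i.val = 1 ∧ j.val = (n + 1) / 2)

lemma chordedWheel_adj {n : ℕ} {i j : Fin n} : (chordedWheel n).Adj i j ↔ i.val ≠ j.val ∧
    ((i.val = 0 ∨ i.val + 1 = j.val ∨ (i.val = 1 ∧ j.val + 1 = n) ∨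
      (0 < i.val ∧ i.val + n / 2 = j.val) ∨ (i.val = 1 ∧ j.val = (n + 1) / 2)) ∨
     (j.val = 0 ∨ j.val + 1 = i.val ∨ (j.val = 1 ∧ i.val + 1 = n) ∨
      (0 < j.val ∧ j.val + n / 2 = i.val) ∨ (j.val = 1 ∧ i.val = (n + 1) / 2))) := by
  simp [chordedWheel, Fin.ext_iff]

lemma degree_eq_card_image {n : ℕ} (G : SimpleGraph (Fin n)) (i : Fin n) (s : Finset ℕ)
    (hs : ∀ k ∈ s, k < n) (h : ∀ j : Fin n, G.Adj i j ↔ j.val ∈ s) : G.degree i = s.card := by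
  rw [← SimpleGraph.card_neighborFinset_eq_degree, ← Finset.card_map Fin.valEmbedding]
  congr 1
  ext k
  simp only [Finset.mem_map, SimpleGraph.mem_neighborFinset, Fin.valEmbedding_apply]
  constructor
  · rintro ⟨j, hj, rfl⟩
    exact (h j).1 hj
  · intro hk
    exact ⟨⟨k, hs k hk⟩, (h _).2 hk, rfl⟩

lemma degree_chordedWheel_zero {n : ℕ} (i : Fin n) (hi : i.val = 0) :
    (chordedWheel n).degree i = n - 1 := by
  rw [degree_eq_card_image _ i (Finset.Ico 1 n) (by simp)]
  · simp
  · intro j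
    have := j.2
    rw [chordedWheel_adj, Finset.mem_Ico]
    omega

lemma degree_chordedWheel_one {n : ℕ} (hn : 37 ≤ n) (i : Fin n) (hi : i.val = 1) :
    (chordedWheel n).degree i = if Even n then 5 else 4 := by
  split_ifs with h
  · obtain ⟨k, rfl⟩ := h
    rw [degree_eq_card_image _ i {0, 2, k + k - 1, 1 + k, k}]
    · have h1 : (0 : ℕ) ∉ ({2, k + k - 1, 1 + k, k} : Finset ℕ) := by simp; omega
      have h2 : (2 : ℕ) ∉ ({k + k - 1, 1 + k, k} : Finset ℕ) := by simp; omega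
      have h3 : (k + k - 1 : ℕ) ∉ ({1 + k, k} : Finset ℕ) := by simp; omega
      have h4 : (1 + k : ℕ) ∉ ({k} : Finset ℕ) := by simp
      rw [Finset.card_insert_of_notMem h1, Finset.card_insert_of_notMem h2,
        Finset.card_insert_of_notMem h3, Finset.card_insert_of_notMem h4, Finset.card_singleton]
    · simp; omega
    · intro j
      have := j.2
      simp only [chordedWheel_adj, Finset.mem_insert, Finset.mem_singleton]
      omega
  · obtain ⟨k, rfl⟩ := Nat.not_even_iff_odd.1 h
    rw [degree_eq_card_image _ i {0, 2, 2 * k, 1 + k}]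
    · have h1 : (0 : ℕ) ∉ ({2, 2 * k, 1 + k} : Finset ℕ) := by simp; omega
      have h2 : (2 : ℕ) ∉ ({2 * k, 1 + k} : Finset ℕ) := by simp; omega
      have h3 : (2 * k : ℕ) ∉ ({1 + k} : Finset ℕ) := by simp; omega
      rw [Finset.card_insert_of_notMem h1, Finset.card_insert_of_notMem h2,
        Finset.card_insert_of_notMem h3, Finset.card_singleton]
    · simp; omega
    · intro j
      have := j.2
      simp only [chordedWheel_adj, Finset.mem_insert, Finset.mem_singleton]
      omega

lemma degree_chordedWheel_of_two_le {n : ℕ} (hn : 37 ≤ n) (i : Fin n) (hi : 2 ≤ i.val) :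
    (chordedWheel n).degree i = 4 := by
  have hin := i.2
  obtain ⟨a, ha⟩ : ∃ a, a = if i.val + 1 = n then 1 else i.val + 1 := ⟨_, rfl⟩
  -- The other end of the chord at `i`. The middle case occurs only for even `n`, where the rim is
  -- odd and `n / 2` is left over, hence joined to `1`.
  obtain ⟨b, hb⟩ : ∃ b, b = if i.val + n / 2 < n then i.val + n / 2
      else if i.val = n / 2 then 1 else i.val - n / 2 := ⟨_, rfl⟩
  rw [degree_eq_card_image _ i {0, i.val - 1, a, b}]
  · have h1 : (0 : ℕ) ∉ ({i.val - 1, a, b} : Finset ℕ) := by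
      simp only [Finset.mem_insert, Finset.mem_singleton]; grind
    have h2 : (i.val - 1 : ℕ) ∉ ({a, b} : Finset ℕ) := by
      simp only [Finset.mem_insert, Finset.mem_singleton]; grind
    have h3 : (a : ℕ) ∉ ({b} : Finset ℕ) := by
      simp only [Finset.mem_singleton]; grind
    rw [Finset.card_insert_of_notMem h1, Finset.card_insert_of_notMem h2,
      Finset.card_insert_of_notMem h3, Finset.card_singleton]
  · simp only [Finset.mem_insert, Finset.mem_singleton]; grind
  · intro j
    have := j.2
    simp only [chordedWheel_adj, Finset.mem_insert, Finset.mem_singleton]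
    split_ifs at ha hb <;> omega

end LowerBound

/-! ### The extremal sequence has no realization containing `K_{2,5}`. -/

section LowerBoundSequence

open scoped Classical

/-- The sequence `(n - 1, 5, 4, …, 4)` if `n` is even and `(n - 1, 4, 4, …, 4)` if `n` is odd. -/
noncomputable def extremalSeq (n : ℕ) (i : Fin n) : ℕ := (chordedWheel n).degree i

lemma extremalSeq_eq {n : ℕ} (hn : 37 ≤ n) (i : Fin n) : extremalSeq n i =
    if i.val = 0 then n - 1 else if i.val = 1 then (if Even n then 5 else 4) else 4 := by
  rw [extremalSeq]
  split_ifs with h0 h1 h2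
  · exact degree_chordedWheel_zero i h0
  · rw [degree_chordedWheel_one hn i h1, if_pos h2]
  · rw [degree_chordedWheel_one hn i h1, if_neg h2]
  · exact degree_chordedWheel_of_two_le hn i (by omega)

lemma isGraphic_extremalSeq {n : ℕ} (hn : 37 ≤ n) : IsGraphic (extremalSeq n) := by
  refine ⟨fun i j hij => ?_, chordedWheel n, fun i => rfl⟩
  rw [extremalSeq_eq hn, extremalSeq_eq hn]
  have : i.val ≤ j.val := hij
  split_ifs <;> omega

lemma extremalSeq_pos {n : ℕ} (hn : 37 ≤ n) (i : Fin n) : 0 < extremalSeq n i := by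
  rw [extremalSeq_eq hn]
  split_ifs <;> omega

lemma sum_extremalSeq {n : ℕ} (hn : 37 ≤ n) :
    ∑ i, extremalSeq n i = if Even n then 5 * n - 4 else 5 * n - 5 := by
  obtain ⟨m, rfl⟩ : ∃ m, n = m + 2 := ⟨n - 2, by omega⟩
  simp only [extremalSeq_eq hn]
  rw [Fin.sum_univ_succ, Fin.sum_univ_succ]
  simp only [Fin.val_zero, Fin.val_succ, Finset.sum_const, Finset.card_univ, Fintype.card_fin,
    smul_eq_mul, Nat.add_eq_zero_iff, one_ne_zero, and_false, if_false, if_true, zero_add,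
    Nat.add_eq_right]
  split_ifs <;> omega

lemma five_le_degrees_of_isContained {V : Type*} [Fintype V] {G : SimpleGraph V}
    (h : (completeBipartiteGraph (Fin 2) (Fin 5)).IsContained G) :
    ∃ u v, u ≠ v ∧ 5 ≤ (commonNbrs G u v).card := by
  obtain ⟨f⟩ := h
  refine ⟨f (Sum.inl 0), f (Sum.inl 1), fun h => ?_, ?_⟩
  · simpa using f.injective h
  · have h1 : (Finset.univ.map ⟨fun j : Fin 5 => f (Sum.inr j),
        fun i j hij => Sum.inr_injective (f.injective hij)⟩) ⊆
          commonNbrs G (f (Sum.inl 0)) (f (Sum.inl 1)) := by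
      intro x hx
      obtain ⟨j, -, rfl⟩ := Finset.mem_map.1 hx
      exact mem_commonNbrs.2 ⟨f.toHom.map_adj (by simp), f.toHom.map_adj (by simp)⟩
    simpa using Finset.card_le_card h1

lemma not_isPotentiallyGraphic_extremalSeq {n : ℕ} (hn : 37 ≤ n) :
    ¬ IsPotentiallyGraphic (completeBipartiteGraph (Fin 2) (Fin 5)) (extremalSeq n) := by
  rintro ⟨-, G, hG, hK⟩
  have hdeg : ∀ i, G.degree i = extremalSeq n i := fun i => by convert hG i
  obtain ⟨u, v, huv, h5⟩ := five_le_degrees_of_isContained hK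
  wlog hlt : u < v generalizing u v
  · exact this v u huv.symm (by rwa [commonNbrs_comm])
      (lt_of_le_of_ne (not_lt.1 hlt) huv.symm)
  have hlt' : u.val < v.val := hlt
  have hsub : commonNbrs G u v ⊆ G.neighborFinset v := fun x hx => by
    simpa using (mem_commonNbrs.1 hx).2
  have hv : 5 ≤ G.degree v := by
    rw [← SimpleGraph.card_neighborFinset_eq_degree]
    exact h5.trans (Finset.card_le_card hsub)
  have hv5 : v.val = 1 ∧ G.degree v = 5 := by
    rw [hdeg, extremalSeq_eq hn] at hv ⊢
    split_ifs at hv ⊢ <;> omega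
  have hu0 : u.val = 0 := by omega
  have hu : G.degree u = n - 1 := by rw [hdeg, extremalSeq_eq hn, if_pos hu0]
  have hall : G.neighborFinset u = Finset.univ.erase u := by
    refine Finset.eq_of_subset_of_card_le (fun x hx => ?_) ?_
    · rw [SimpleGraph.mem_neighborFinset] at hx
      simpa using hx.ne'
    · rw [SimpleGraph.card_neighborFinset_eq_degree, hu]
      simp
  have hadj : G.Adj u v := by
    rw [← SimpleGraph.mem_neighborFinset, hall]
    simpa using huv.symm
  -- The dominating vertex `u` is a sixth neighbour of `v`, which has degree 5.
  have hins : insert u (commonNbrs G u v) ⊆ G.neighborFinset v :=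
    Finset.insert_subset (by simpa using hadj.symm) hsub
  have hcard := Finset.card_le_card hins
  rw [Finset.card_insert_of_notMem (fun h => (mem_commonNbrs.1 h).1.ne rfl),
    SimpleGraph.card_neighborFinset_eq_degree] at hcard
  omega

lemma sum_extremalSeq_lt_of_mem_forcingSums {n m : ℕ} (hn : 37 ≤ n)
    (hm : m ∈ forcingSums (completeBipartiteGraph (Fin 2) (Fin 5)) n) :
    (if Even n then 5 * n - 4 else 5 * n - 5) < m := by
  by_contra! h
  exact not_isPotentiallyGraphic_extremalSeq hn
    (hm.2 _ (isGraphic_extremalSeq hn) (extremalSeq_pos hn) (by rwa [sum_extremalSeq hn]))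

end LowerBoundSequence

theorem mainTheorem2 (n : ℕ) (hn : 37 ≤ n) :
    (Odd n → IsSigma (completeBipartiteGraph (Fin 2) (Fin 5)) n (5 * n - 3)) ∧
    (Even n → IsSigma (completeBipartiteGraph (Fin 2) (Fin 5)) n (5 * n - 2)) := by
  constructor
  · intro hodd
    refine ⟨⟨?_, fun d hd _ hs => isPotentiallyGraphic_two_five hn hd (by omega)⟩, fun m hm => ?_⟩
    · rw [Nat.even_iff]
      rw [Nat.odd_iff] at hodd
      omega
    · have h1 := sum_extremalSeq_lt_of_mem_forcingSums hn hm
      rw [if_neg (Nat.not_even_iff_odd.2 hodd)] at h1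
      -- Both `m` and `5n - 5` are even, so the strict inequality gains 2.
      have h2 := Nat.even_iff.1 hm.1
      rw [Nat.odd_iff] at hodd
      omega
  · intro heven
    refine ⟨⟨?_, fun d hd _ hs => isPotentiallyGraphic_two_five hn hd (by omega)⟩, fun m hm => ?_⟩
    · rw [Nat.even_iff] at heven ⊢
      omega
    · have h1 := sum_extremalSeq_lt_of_mem_forcingSums hn hm
      rw [if_pos heven] at h1
      have h2 := Nat.even_iff.1 hm.1
      rw [Nat.even_iff] at heven
      omega
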